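/- Let $\Delta$ be a complete unimodular fan in $V=\mathbb{R}^n$ with respect to the lattice $N=\mathbb{Z}^n$, and suppose that $\Delta$ is polytopal, i.e. $\Delta$ is the normal fan of an $n$-dimensional convex polytope $P\subset V^*$ (the collection, over all nonempty faces $F$ of $P$, of the cones spanned by the outward normal vectors to the facets of $P$ containing $F$). Equivalently, the toric variety $X_\Delta$ is smooth and projective. Let $\lambda(1),\dots,\lambda(m)\in N$ be the primitive generators of the rays of $\Delta$, and let $K$ be the simplicial complex on $[m]=\{1,\dots,m\}$ of those $I\subseteq[m]$ for which $\{\lambda(i)\}_{i\in I}$ spans a cone of $\Delta$. Describe the cohomology of $X_\Delta$ by the Danilov–Jurkiewicz presentation $$H^*(X_\Delta;\mathbb{R})=\mathbb{R}[v_1,\dots,v_m]\Big/\Big(v_{i_1}\cdots v_{i_s}\ \big(\{i_1,\dots,i_s\}\notin K\big),\ \ \sum_{i\in[m]}\langle\mu,\lambda(i)\rangle v_i\ \big(\mu\in \mathrm{Hom}(N,\mathbb{Z})\big)\Big),\qquad \deg v_i=2.$$ A wall is a simplex $J\in K$ with $|J|=n-1$, and its class is $v_J=\prod_{i\in J}v_i\in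 H^{2n-2}(X_\Delta;\mathbb{R})$. Then the effective cone $$\mathrm{NE}(X_\Delta)=\Big\{\sum_{J} r_Jv_J\in H^{2n-2}(X_\Delta;\mathbb{R})\ \Big|\ r_J\ge 0\Big\},$$ where the sums run over all walls $J$, is a strictly convex polyhedral cone in $H^{2n-2}(X_\Delta;\mathbb{R})$: it is finitely generated and $\mathrm{NE}(X_\Delta)\cap(-\mathrm{NE}(X_\Delta))=\{0\}$. Moreover, $v_J\neq 0$ for every wall $J$. -/

import Mathlib

open scoped BigOperators

noncomputable section

/-- The image in `V = ℝⁿ` of a vector of the lattice `N = ℤⁿ`. -/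
def latticeVec {n : ℕ} (v : Fin n → ℤ) : Fin n → ℝ := fun k => (v k : ℝ)

/-- A complete unimodular fan `Δ` in `V = ℝⁿ` with lattice `N = ℤⁿ` and with `m` rays.
The rays are numbered by `[m] = Fin m`; `lam i` is the primitive generator of the `i`-th ray,
`K` is the underlying simplicial complex (it contains the empty simplex), and the cones of the
fan are the cones spanned by `lam i`, `i ∈ I`, for the simplices `I ∈ K`. -/
structure CompleteUnimodularFan (n m : ℕ) where
  /-- the characteristic function -/
  lam : Fin m → (Fin n → ℤ)
  /-- different indices give different rays -/
  lam_injective : Function.Injective lam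
  /-- the simplices of the underlying simplicial complex -/
  K : Set (Finset (Fin m))
  /-- `K` is a simplicial complex (a face of a cone of the fan is a cone of the fan) -/
  down_closed : ∀ I ∈ K, ∀ J, J ⊆ I → J ∈ K
  /-- each `i` indexes a ray of the fan -/
  singleton_mem : ∀ i, {i} ∈ K
  /-- each cone of the fan is generated by a part of a basis of the lattice -/
  unimodular : ∀ I ∈ K, ∃ b : Module.Basis (Fin n) ℤ (Fin n → ℤ), ∀ i ∈ I, lam i ∈ Set.range b
  /-- two cones of the fan intersect in a common face, spanned by the common generators -/
  inter : ∀ I ∈ K, ∀ J ∈ K,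
    PointedCone.hull ℝ ((fun i => latticeVec (lam i)) '' (I : Set (Fin m))) ⊓
      PointedCone.hull ℝ ((fun i => latticeVec (lam i)) '' (J : Set (Fin m))) =
    PointedCone.hull ℝ ((fun i => latticeVec (lam i)) '' ((I ∩ J : Finset (Fin m)) : Set (Fin m)))
  /-- the cones of the fan cover `ℝⁿ` -/
  complete : ∀ x : Fin n → ℝ, ∃ I ∈ K,
    x ∈ PointedCone.hull ℝ ((fun i => latticeVec (lam i)) '' (I : Set (Fin m)))

/-! ### Polytopes in the dual space and their normal fans

The dual space of `ℝⁿ` is identified with `ℝⁿ` by the pairing `⟨x, y⟩ = x ⬝ᵥ y`. -/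

/-- `P` is an `n`-dimensional convex polytope in `ℝⁿ`. -/
def IsFullDimPolytope {n : ℕ} (P : Set (Fin n → ℝ)) : Prop :=
  (∃ S : Set (Fin n → ℝ), S.Finite ∧ P = convexHull ℝ S) ∧ (interior P).Nonempty

/-- `F` is a nonempty face of the polytope `P` (the whole polytope is allowed). -/
def IsPolytopeFace {n : ℕ} (P F : Set (Fin n → ℝ)) : Prop :=
  F.Nonempty ∧ IsExposed ℝ P F

/-- `G` is a facet of `P`: a face of dimension `n - 1`. -/
def IsPolytopeFacet {n : ℕ} (P G : Set (Fin n → ℝ)) : Prop :=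
  IsPolytopeFace P G ∧ Module.finrank ℝ (vectorSpan ℝ G) + 1 = n

/-- `y` is an outward normal vector to the facet `G` of `P`. -/
def IsOutwardNormal {n : ℕ} (P G : Set (Fin n → ℝ)) (y : Fin n → ℝ) : Prop :=
  y ≠ 0 ∧ ∀ g ∈ G, ∀ x ∈ P, x ⬝ᵥ y ≤ g ⬝ᵥ y

/-- The cone spanned by the outward normal vectors to the facets of `P` that contain `F`. -/
def normalCone {n : ℕ} (P F : Set (Fin n → ℝ)) : PointedCone ℝ (Fin n → ℝ) :=
  PointedCone.hull ℝ {y | ∃ G, IsPolytopeFacet P G ∧ F ⊆ G ∧ IsOutwardNormal P G y}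

/-- The normal fan of `P`, as a collection of cones. -/
def normalFan {n : ℕ} (P : Set (Fin n → ℝ)) : Set (PointedCone ℝ (Fin n → ℝ)) :=
  {σ | ∃ F, IsPolytopeFace P F ∧ σ = normalCone P F}

namespace CompleteUnimodularFan

variable {n m : ℕ} (Δ : CompleteUnimodularFan n m)

/-- The cone spanned by `lam i`, `i ∈ I`. -/
def cone (I : Finset (Fin m)) : PointedCone ℝ (Fin n → ℝ) :=
  PointedCone.hull ℝ ((fun i => latticeVec (Δ.lam i)) '' (I : Set (Fin m)))

/-- The fan as a collection of cones. -/
def cones : Set (PointedCone ℝ (Fin n → ℝ)) :=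
  {σ | ∃ I ∈ Δ.K, σ = Δ.cone I}

/-- The fan is polytopal, i.e. the toric variety `X_Δ` is projective: `Δ` is the normal fan of
a convex polytope. -/
def IsPolytopal : Prop :=
  ∃ P : Set (Fin n → ℝ), IsFullDimPolytope P ∧ normalFan P = Δ.cones

/-! ### The cohomology ring, in the Danilov–Jurkiewicz description -/

/-- The Stanley–Reisner ideal of `K`. -/
def stanleyReisnerIdeal : Ideal (MvPolynomial (Fin m) ℝ) :=
  Ideal.span {p | ∃ I : Finset (Fin m), I ∉ Δ.K ∧ p = ∏ i ∈ I, MvPolynomial.X i}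

/-- The ideal generated by the linear forms `∑ ⟨μ, lam i⟩ v_i`, `μ : N → ℤ` linear. -/
def linearIdeal : Ideal (MvPolynomial (Fin m) ℝ) :=
  Ideal.span {p | ∃ μ : (Fin n → ℤ) →ₗ[ℤ] ℤ,
    p = ∑ i, MvPolynomial.C ((μ (Δ.lam i) : ℤ) : ℝ) * MvPolynomial.X i}

/-- The ring `H^*(X_Δ; ℝ) = ℝ[K] / Θ`, in which `v_i` has degree `2`. -/
abbrev Cohomology : Type :=
  MvPolynomial (Fin m) ℝ ⧸ (Δ.stanleyReisnerIdeal ⊔ Δ.linearIdeal)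

/-- The class `v_i ∈ H^2(X_Δ; ℝ)`. -/
def v (i : Fin m) : Δ.Cohomology :=
  Ideal.Quotient.mkₐ ℝ (Δ.stanleyReisnerIdeal ⊔ Δ.linearIdeal) (MvPolynomial.X i)

/-- The graded piece `H^{2k}(X_Δ; ℝ)`: the classes of the homogeneous polynomials of degree `k`
in the `v_i`. -/
def evenCohomology (k : ℕ) : Submodule ℝ Δ.Cohomology :=
  (MvPolynomial.homogeneousSubmodule (Fin m) ℝ k).map
    (Ideal.Quotient.mkₐ ℝ (Δ.stanleyReisnerIdeal ⊔ Δ.linearIdeal)).toLinearMap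

/-- A monomial `v_J` with `|J| = k` lies in `H^{2k}`. -/
theorem prod_v_mem (J : Finset (Fin m)) {k : ℕ} (hJ : J.card = k) :
    ∏ i ∈ J, Δ.v i ∈ Δ.evenCohomology k := by
  subst hJ
  refine Submodule.mem_map.2 ⟨∏ i ∈ J, MvPolynomial.X i, ?_, ?_⟩
  · rw [MvPolynomial.mem_homogeneousSubmodule]
    have h := MvPolynomial.IsHomogeneous.prod J
      (fun i => (MvPolynomial.X i : MvPolynomial (Fin m) ℝ)) (fun _ => 1)
      (fun i _ => MvPolynomial.isHomogeneous_X ℝ i)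
    simpa using h
  · rw [AlgHom.toLinearMap_apply, map_prod]
    rfl

/-- The walls: simplices `J ∈ K` with `n - 1` vertices (there are none if `n = 0`). -/
def Wall : Type := {J : Finset (Fin m) // J ∈ Δ.K ∧ J.card + 1 = n}

/-- The class `v_J ∈ H^{2n-2}(X_Δ; ℝ)` of a wall `J`, the product of the `v_i`, `i ∈ J`. -/
def wallClass (J : Δ.Wall) : Δ.evenCohomology (n - 1) :=
  ⟨∏ i ∈ J.1, Δ.v i, Δ.prod_v_mem J.1 (Nat.eq_sub_of_add_eq J.2.2)⟩

/-- The cone `NE(X_Δ)` of all combinations of the classes `v_J` with nonnegative real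
coefficients. -/
def effectiveCone : PointedCone ℝ (Δ.evenCohomology (n - 1)) :=
  PointedCone.hull ℝ (Set.range Δ.wallClass)

end CompleteUnimodularFan

end

/-! There are finitely many walls, so everything follows from a linear functional on $H^{2n-2}$ that
is positive on every $v_J$: then a nonzero element of the cone has positive value, its negative
cannot lie in the cone, and no $v_J$ vanishes. The functional is intersection with the ample divisor
$D_P=\sum_i h_P(\lambda(i))v_i$, where $h_P$ is the support function of $P$.

Integration over $X_\Delta$ is replaced by the localization formula at a fixed generic $t\in V$:
$\int f=\sum_I f|_I(t)/\prod_{i\in I}u_i^I(t)$ over maximal simplices $I$, where $u_i^I$ are the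
coordinates dual to $\lambda(i)$, $i\in I$, and $f|_I$ substitutes $u_i^I$ for $v_i$ if $i\in I$ and
$0$ otherwise. The key fact is `integral_eq_zero`: $\int f=0$ if $\deg f<n$. Partial fractions along
a generic line through $t$ turn the sum into residues on walls, and the residues from the two sides
of a wall cancel (`exists_isWallPair`).

The functional $f\mapsto\int f_{n-1}D_P$, with $f_{n-1}$ the homogeneous component of degree $n-1$,
descends to cohomology: monomials of non-simplices restrict to $0$ at every $I$, and the linear form
of $\mu$ restricts to the same scalar $\mu(t)$ at every $I$, which factors out and leaves an
integrand of degree less than $n$. On $v_J$ only the two maximal simplices containing $J$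
contribute, and they give $\langle p-q,\lambda(a)\rangle>0$, where $p\ne q$ are the corresponding
vertices of $P$ and $a$ is the extra vertex of the simplex of $p$. -/

noncomputable section

/-! ### Dual coordinates on the cones of a unimodular fan -/

/-- The real-linear extension of an integral linear form. -/
def realExtension {n : ℕ} (f : (Fin n → ℤ) →ₗ[ℤ] ℤ) : Module.Dual ℝ (Fin n → ℝ) :=
  ∑ k, ((f (Pi.single k 1) : ℤ) : ℝ) • LinearMap.proj k

theorem realExtension_latticeVec {n : ℕ} (f : (Fin n → ℤ) →ₗ[ℤ] ℤ) (v : Fin n → ℤ) :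
    realExtension f (latticeVec v) = (f v : ℤ) := by
  rw [LinearMap.pi_apply_eq_sum_univ f v]
  simp only [realExtension, latticeVec, LinearMap.sum_apply, LinearMap.smul_apply,
    LinearMap.proj_apply, smul_eq_mul, Int.cast_sum, Int.cast_mul]
  refine Finset.sum_congr rfl fun k _ => ?_
  rw [mul_comm]
  congr 3
  ext j
  simp [Pi.single_apply, eq_comm]

namespace CompleteUnimodularFan

variable {n m : ℕ} (Δ : CompleteUnimodularFan n m)

/-- The primitive generator of the `i`-th ray, as a real vector. -/
def vec (i : Fin m) : Fin n → ℝ := latticeVec (Δ.lam i)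

/-- Part of the dual of a lattice basis containing the generators. Integrality is recorded because
it later normalizes the relation across a wall; the value zero off `I` makes restriction to `I` kill
the other variables. -/
theorem exists_coord {I : Finset (Fin m)} (hI : I ∈ Δ.K) :
    ∃ u : Fin m → Module.Dual ℝ (Fin n → ℝ), (∀ i, i ∉ I → u i = 0) ∧
      (∀ i ∈ I, ∀ j ∈ I, u i (Δ.vec j) = if i = j then 1 else 0) ∧
      ∀ i j, ∃ z : ℤ, u i (Δ.vec j) = z := by
  classical
  obtain ⟨b, hb⟩ := Δ.unimodular I hI
  choose σ hσ using hb
  refine ⟨fun i => if hi : i ∈ I then realExtension (b.coord (σ i hi)) else 0,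
    fun i hi => dif_neg hi,
    fun i hi j hj => ?_, fun i j => ?_⟩
  · simp only [dif_pos hi, vec, realExtension_latticeVec, Module.Basis.coord_apply]
    rw [← hσ j hj, Module.Basis.repr_self, Finsupp.single_apply]
    by_cases h : i = j
    · simp [h]
    · have : σ j hj ≠ σ i hi := fun h' => h (Δ.lam_injective (by rw [← hσ i hi, ← hσ j hj, h']))
      simp [h, this]
  · by_cases hi : i ∈ I
    · exact ⟨_, by simp only [dif_pos hi]; exact realExtension_latticeVec _ _⟩
    · exact ⟨0, by simp [hi]⟩

open Classical in
/-- The coordinates with respect to the generators of the cone of `I`, as linear forms. -/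
def coord (I : Finset (Fin m)) : Fin m → Module.Dual ℝ (Fin n → ℝ) :=
  if h : I ∈ Δ.K then (Δ.exists_coord h).choose else 0

variable {Δ}
variable {I J : Finset (Fin m)}

theorem coord_of_notMem (hI : I ∈ Δ.K) {i : Fin m} (hi : i ∉ I) : Δ.coord I i = 0 := by
  rw [coord, dif_pos hI]
  exact (Δ.exists_coord hI).choose_spec.1 i hi

theorem coord_vec (hI : I ∈ Δ.K) {i j : Fin m} (hj : j ∈ I) :
    Δ.coord I i (Δ.vec j) = if i = j then 1 else 0 := by
  by_cases hi : i ∈ I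
  · rw [coord, dif_pos hI]
    exact (Δ.exists_coord hI).choose_spec.2.1 i hi j hj
  · rw [coord_of_notMem hI hi, if_neg (fun h => hi (by rw [h]; exact hj))]
    rfl

theorem exists_int_coord_vec (hI : I ∈ Δ.K) (i j : Fin m) :
    ∃ z : ℤ, Δ.coord I i (Δ.vec j) = z := by
  rw [coord, dif_pos hI]
  exact (Δ.exists_coord hI).choose_spec.2.2 i j

variable (Δ) in
/-- The linear span of the cone of `I`. -/
def linSpan (I : Finset (Fin m)) : Submodule ℝ (Fin n → ℝ) :=
  Submodule.span ℝ (Δ.vec '' (I : Set (Fin m)))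

theorem vec_mem_linSpan {i : Fin m} (hi : i ∈ I) : Δ.vec i ∈ Δ.linSpan I :=
  Submodule.subset_span ⟨i, hi, rfl⟩

theorem sum_smul_mem_linSpan (c : Fin m → ℝ) : ∑ i ∈ I, c i • Δ.vec i ∈ Δ.linSpan I :=
  Submodule.sum_mem _ fun _ hi => Submodule.smul_mem _ _ (vec_mem_linSpan hi)

theorem sum_coord_smul_of_mem_linSpan (hI : I ∈ Δ.K) {x : Fin n → ℝ} (hx : x ∈ Δ.linSpan I) :
    ∑ i ∈ I, Δ.coord I i x • Δ.vec i = x := by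
  induction hx using Submodule.span_induction with
  | mem x hx =>
    obtain ⟨j, hj, rfl⟩ := hx
    simp only [coord_vec hI (Finset.mem_coe.1 hj)]
    simp [Finset.mem_coe.1 hj]
  | zero => simp
  | add x y _ _ hx hy =>
    simp only [map_add, add_smul, Finset.sum_add_distrib, hx, hy]
  | smul a x _ hx =>
    simp only [map_smul, smul_eq_mul, mul_smul, ← Finset.smul_sum, hx]

theorem coord_sum_smul (hI : I ∈ Δ.K) (c : Fin m → ℝ) (hJ : J ⊆ I) (i : Fin m) :
    Δ.coord I i (∑ j ∈ J, c j • Δ.vec j) = if i ∈ J then c i else 0 := by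
  rw [map_sum, Finset.sum_congr rfl fun j hj => by
    rw [map_smul, coord_vec hI (hJ hj), smul_eq_mul, mul_ite, mul_one, mul_zero]]
  simp

theorem coord_eq_zero_of_mem_linSpan (hI : I ∈ Δ.K) (hJ : J ⊆ I) {i : Fin m} (hi : i ∉ J)
    {x : Fin n → ℝ} (hx : x ∈ Δ.linSpan J) : Δ.coord I i x = 0 := by
  rw [← sum_coord_smul_of_mem_linSpan (Δ.down_closed I hI J hJ) hx, coord_sum_smul hI _ hJ,
    if_neg hi]

theorem vec_notMem_linSpan {i : Fin m} (hi : i ∉ J) (h : insert i J ∈ Δ.K) :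
    Δ.vec i ∉ Δ.linSpan J := fun hx => by
  have := coord_eq_zero_of_mem_linSpan h (Finset.subset_insert i J) hi hx
  rw [coord_vec h (Finset.mem_insert_self i J), if_pos rfl] at this
  exact one_ne_zero this

theorem linearIndependent_vec (hI : I ∈ Δ.K) :
    LinearIndependent ℝ (fun i : I => Δ.vec i) := by
  rw [Fintype.linearIndependent_iff]
  intro g hg i
  have := congrArg (Δ.coord I i) hg
  rw [map_sum, map_zero] at this
  simp only [map_smul, coord_vec hI (Subtype.coe_prop _), smul_eq_mul, mul_ite, mul_one, mul_zero,
    Subtype.coe_inj] at this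
  simpa using this

theorem finrank_linSpan (hI : I ∈ Δ.K) : Module.finrank ℝ (Δ.linSpan I) = I.card := by
  have := finrank_span_eq_card (linearIndependent_vec hI)
  rw [Fintype.card_coe] at this
  have hr : Set.range (fun i : I => Δ.vec i) = Δ.vec '' (I : Set (Fin m)) := by
    ext x
    simp
  rw [← this, linSpan, hr]

theorem card_le (hI : I ∈ Δ.K) : I.card ≤ n := by
  rw [← finrank_linSpan hI]
  simpa using Submodule.finrank_le (Δ.linSpan I)

theorem linSpan_eq_top (hI : I ∈ Δ.K) (hn : I.card = n) : Δ.linSpan I = ⊤ :=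
  Submodule.eq_top_of_finrank_eq (by rw [finrank_linSpan hI, hn]; simp)

theorem sum_coord_smul (hI : I ∈ Δ.K) (hn : I.card = n) (x : Fin n → ℝ) :
    ∑ i ∈ I, Δ.coord I i x • Δ.vec i = x :=
  sum_coord_smul_of_mem_linSpan hI (by rw [linSpan_eq_top hI hn]; trivial)

theorem mem_cone_iff (hI : I ∈ Δ.K) {x : Fin n → ℝ} :
    x ∈ Δ.cone I ↔ ∑ i ∈ I, Δ.coord I i x • Δ.vec i = x ∧ ∀ i ∈ I, 0 ≤ Δ.coord I i x := by
  constructor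
  · intro hx
    refine ⟨sum_coord_smul_of_mem_linSpan hI (PointedCone.hull_le_span _ _ hx), fun i _ => ?_⟩
    induction hx using Submodule.span_induction with
    | mem x hx =>
      obtain ⟨j, hj, rfl⟩ := hx
      have := coord_vec (i := i) hI (Finset.mem_coe.1 hj)
      rw [vec] at this
      rw [this]
      split_ifs <;> simp
    | zero => simp
    | add x y _ _ hx hy => rw [map_add]; exact add_nonneg hx hy
    | smul a x _ hx =>
      change 0 ≤ Δ.coord I i ((a : ℝ) • x)
      rw [map_smul]; exact mul_nonneg a.2 hx
  · rintro ⟨hx, h0⟩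
    rw [← hx]
    exact Submodule.sum_mem _ fun i hi =>
      PointedCone.smul_mem _ (h0 i hi) (Submodule.subset_span ⟨i, hi, rfl⟩)

theorem sum_smul_mem_cone {c : Fin m → ℝ} (hc : ∀ i ∈ I, 0 ≤ c i) :
    ∑ i ∈ I, c i • Δ.vec i ∈ Δ.cone I :=
  Submodule.sum_mem _ fun i hi =>
    PointedCone.smul_mem _ (hc i hi) (Submodule.subset_span ⟨i, hi, rfl⟩)

theorem cone_inf_cone (hI : I ∈ Δ.K) (hJ : J ∈ Δ.K) :
    Δ.cone I ⊓ Δ.cone J = Δ.cone (I ∩ J) := Δ.inter I hI J hJ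

theorem cone_le_linSpan {x : Fin n → ℝ} (hx : x ∈ Δ.cone I) : x ∈ Δ.linSpan I :=
  PointedCone.hull_le_span _ _ hx

theorem isClosed_cone (hI : I ∈ Δ.K) : IsClosed (Δ.cone I : Set (Fin n → ℝ)) := by
  have : (Δ.cone I : Set (Fin n → ℝ)) = {x | ∑ i ∈ I, Δ.coord I i x • Δ.vec i = x} ∩
      ⋂ i ∈ I, {x | 0 ≤ Δ.coord I i x} := by
    ext x
    simp [mem_cone_iff hI]
  have hc (i : Fin m) : Continuous (Δ.coord I i) := LinearMap.continuous_of_finiteDimensional _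
  rw [this]
  refine (isClosed_eq ?_ continuous_id).inter (isClosed_biInter fun i _ =>
    isClosed_le continuous_const (hc i))
  exact continuous_finsetSum _ fun i _ => (hc i).smul continuous_const

end CompleteUnimodularFan

end

/-! ### Walls and their two adjacent maximal cones -/

noncomputable section
namespace CompleteUnimodularFan

variable {n m : ℕ} {Δ : CompleteUnimodularFan n m} {I J : Finset (Fin m)}

/-- Starting from an interior point of a simplex `J` and moving slightly in direction `w` one stays
in the cone of some simplex containing `J`. -/
theorem exists_superset_mem_cone (hJ : J ∈ Δ.K) (w : Fin n → ℝ) :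
    ∃ I ∈ Δ.K, J ⊆ I ∧ ∃ ε : ℝ, 0 < ε ∧ ∑ j ∈ J, Δ.vec j + ε • w ∈ Δ.cone I := by
  -- The points approach the sum of the generators of `J`. Since there are finitely many simplices,
  -- one of them serves infinitely many points, and its closed cone contains the limit.
  choose I hIK hI using fun k : ℕ => Δ.complete (∑ j ∈ J, Δ.vec j + (1 / ((k : ℝ) + 1)) • w)
  obtain ⟨I₀, hI₀⟩ := Finite.exists_infinite_fiber I
  have hfreq : ∃ᶠ k in Filter.atTop, I k = I₀ :=
    Nat.frequently_atTop_iff_infinite.2 (Set.infinite_coe_iff.1 hI₀)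
  obtain ⟨k, hk⟩ := hfreq.exists
  have hIK₀ : I₀ ∈ Δ.K := hk ▸ hIK k
  have hlim : ∑ j ∈ J, Δ.vec j ∈ Δ.cone I₀ := by
    refine (isClosed_cone hIK₀).mem_of_frequently_of_tendsto
      (f := fun k : ℕ => ∑ j ∈ J, Δ.vec j + (1 / ((k : ℝ) + 1)) • w)
      (hfreq.mono fun k hk => hk ▸ hI k) ?_
    have := (tendsto_one_div_add_atTop_nhds_zero_nat (𝕜 := ℝ)).smul_const w
    simpa using this.const_add (∑ j ∈ J, Δ.vec j)
  refine ⟨I₀, hIK₀, ?_, 1 / ((k : ℝ) + 1), by positivity, hk ▸ hI k⟩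
  -- The limit lies in the cone of `I₀ ∩ J`, yet all its coordinates in `J` equal 1, so no vertex of
  -- `J` is missing from `I₀`.
  intro j hj
  by_contra hjI
  have h1 : ∑ j ∈ J, Δ.vec j ∈ Δ.cone J := by
    simpa using sum_smul_mem_cone (Δ := Δ) (I := J) (c := fun _ => 1) (by simp)
  have h2 : ∑ j ∈ J, Δ.vec j ∈ Δ.cone (I₀ ∩ J) := by
    rw [← cone_inf_cone hIK₀ hJ]; exact ⟨hlim, h1⟩
  have h3 := coord_eq_zero_of_mem_linSpan (i := j) hJ Finset.inter_subset_right (by simp [hjI])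
    (cone_le_linSpan h2)
  have h4 := coord_sum_smul hJ (fun _ => (1 : ℝ)) subset_rfl j
  simp only [one_smul, if_pos hj] at h4
  exact one_ne_zero (h4.symm.trans h3)

/-- A small push off the wall towards `w` lands in the cone of a simplex strictly containing `J`. By
the bound `n` on cardinality it has exactly one more vertex, and this lies on the same side as `w`.
-/
theorem exists_insert_mem_of_notMem_linSpan (hJ : J ∈ Δ.K) (hn : J.card + 1 = n)
    {w : Fin n → ℝ} (hw : w ∉ Δ.linSpan J) :
    ∃ i, i ∉ J ∧ insert i J ∈ Δ.K ∧ ∃ c : ℝ, 0 < c ∧ w - c • Δ.vec i ∈ Δ.linSpan J := by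
  obtain ⟨I, hI, hJI, ε, hε, hmem⟩ := exists_superset_mem_cone hJ w
  have hsum : ∑ j ∈ J, Δ.vec j ∈ Δ.linSpan J :=
    Submodule.sum_mem _ fun _ hj => vec_mem_linSpan hj
  have hne : I ≠ J := by
    rintro rfl
    have := (Submodule.add_mem_iff_right _ hsum).1 (cone_le_linSpan hmem)
    exact hw ((Submodule.smul_mem_iff _ hε.ne').1 this)
  obtain ⟨i, hiI, hiJ⟩ := Finset.exists_of_ssubset (hJI.ssubset_of_ne hne.symm)
  have hIeq : insert i J = I := by
    refine Finset.eq_of_subset_of_card_le (Finset.insert_subset hiI hJI) ?_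
    rw [Finset.card_insert_of_notMem hiJ, hn]
    exact card_le hI
  subst hIeq
  obtain ⟨hx, h0⟩ := (mem_cone_iff hI).1 hmem
  set u := Δ.coord (insert i J) i (∑ j ∈ J, Δ.vec j + ε • w) with hu
  rw [Finset.sum_insert hiJ, ← hu] at hx
  have hdiff : w - (u / ε) • Δ.vec i ∈ Δ.linSpan J := by
    rw [← Submodule.smul_mem_iff _ hε.ne', smul_sub, smul_smul, mul_div_cancel₀ _ hε.ne']
    have : ε • w - u • Δ.vec i = ∑ j ∈ J, Δ.coord (insert i J) j
        (∑ j ∈ J, Δ.vec j + ε • w) • Δ.vec j - ∑ j ∈ J, Δ.vec j := by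
      rw [eq_sub_of_add_eq' hx]
      abel
    rw [this]
    exact Submodule.sub_mem _ (sum_smul_mem_linSpan _) hsum
  refine ⟨i, hiJ, hI, u / ε, ?_, hdiff⟩
  refine (div_nonneg (h0 i (Finset.mem_insert_self i J)) hε.le).lt_of_ne fun h => hw ?_
  rwa [← h, zero_smul, sub_zero] at hdiff

/-- Otherwise two cones on one side of the wall would overlap beyond it: `vec i`, moved far enough
along the wall, lies in both, hence in the cone of `J`. -/
theorem eq_of_same_side (hJ : J ∈ Δ.K) {i a : Fin m} (hiJ : i ∉ J) (haJ : a ∉ J)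
    (hi : insert i J ∈ Δ.K) (ha : insert a J ∈ Δ.K) {r : ℝ} (hr : 0 < r)
    (h : Δ.vec i - r • Δ.vec a ∈ Δ.linSpan J) : i = a := by
  by_contra hia
  set c : Fin m → ℝ := fun j => Δ.coord J j (Δ.vec i - r • Δ.vec a) with hc
  have hsum : Δ.vec i = r • Δ.vec a + ∑ j ∈ J, c j • Δ.vec j := by
    rw [hc, sum_coord_smul_of_mem_linSpan hJ h]; abel
  -- The shift `|c j|` makes both `|c j|` and `c j + |c j|` nonnegative.
  set x := Δ.vec i + ∑ j ∈ J, |c j| • Δ.vec j with hx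
  have h1 : x ∈ Δ.cone (insert i J) := by
    have : x = ∑ j ∈ insert i J, (if j = i then 1 else |c j|) • Δ.vec j := by
      rw [Finset.sum_insert hiJ, if_pos rfl, one_smul, hx]
      congr 1
      exact Finset.sum_congr rfl fun j hj => by rw [if_neg (fun h => hiJ (by rwa [← h]))]
    rw [this]
    exact sum_smul_mem_cone fun j _ => by split_ifs <;> positivity
  have h2 : x ∈ Δ.cone (insert a J) := by
    have : x = ∑ j ∈ insert a J, (if j = a then r else c j + |c j|) • Δ.vec j := by
      rw [Finset.sum_insert haJ, if_pos rfl, hx, hsum, add_assoc, ← Finset.sum_add_distrib]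
      congr 1
      exact Finset.sum_congr rfl fun j hj => by
        rw [if_neg (fun h => haJ (by rwa [← h])), add_smul]
    rw [this]
    refine sum_smul_mem_cone fun j _ => ?_
    split_ifs
    · exact hr.le
    · linarith [neg_abs_le (c j)]
  have h3 : x ∈ Δ.cone J := by
    have h : insert i J ∩ insert a J = J := by
      ext j
      simp only [Finset.mem_inter, Finset.mem_insert]
      grind
    rw [← h, ← cone_inf_cone hi ha]
    exact ⟨h1, h2⟩
  refine vec_notMem_linSpan hiJ hi ?_
  exact (Submodule.add_mem_iff_left _ (sum_smul_mem_linSpan _)).1 (cone_le_linSpan h3)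

/-- `a` and `b` are the two vertices completing the wall `J` to maximal simplices. -/
structure IsWallPair (Δ : CompleteUnimodularFan n m) (J : Finset (Fin m)) (a b : Fin m) :
    Prop where
  left_notMem : a ∉ J
  right_notMem : b ∉ J
  ne : a ≠ b
  left_mem : insert a J ∈ Δ.K
  right_mem : insert b J ∈ Δ.K
  eq_or_eq : ∀ i, i ∉ J → insert i J ∈ Δ.K → i = a ∨ i = b
  add_mem : Δ.vec a + Δ.vec b ∈ Δ.linSpan J

/-- Pushing off the wall in the directions `w` and `-w` gives `a` and `b`; any further completion
lies on one of the two sides, so it is one of them. -/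
theorem exists_isWallPair (hJ : J ∈ Δ.K) (hn : J.card + 1 = n) :
    ∃ a b, IsWallPair Δ J a b := by
  obtain ⟨w, hw⟩ : ∃ w, w ∉ Δ.linSpan J := by
    by_contra! h
    have h1 := finrank_linSpan hJ
    rw [Submodule.eq_top_iff'.2 h, finrank_top, Module.finrank_fin_fun] at h1
    omega
  obtain ⟨a, haJ, ha, c, hc, hac⟩ := exists_insert_mem_of_notMem_linSpan hJ hn hw
  obtain ⟨b, hbJ, hb, d, hd, hbd⟩ := exists_insert_mem_of_notMem_linSpan hJ hn
    (w := -w) (by rwa [neg_mem_iff])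
  have hab : a ≠ b := by
    rintro rfl
    refine vec_notMem_linSpan haJ ha ?_
    have h := Submodule.add_mem _ hac hbd
    have h' : w - c • Δ.vec a + (-w - d • Δ.vec a) = (-(c + d)) • Δ.vec a := by module
    rw [h'] at h
    exact (Submodule.smul_mem_iff _ (by linarith)).1 h
  have hsum : c • Δ.vec a + d • Δ.vec b ∈ Δ.linSpan J := by
    have h := Submodule.neg_mem _ (Submodule.add_mem _ hac hbd)
    have h' : -(w - c • Δ.vec a + (-w - d • Δ.vec b)) = c • Δ.vec a + d • Δ.vec b := by module
    rwa [h'] at h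
  -- Let `y` be the `a`-coordinate of `vec b` and `z` the `b`-coordinate of `vec a`. Both are
  -- integers with `y * z = 1`, and `c + d * y = 0` with `c, d > 0` forces `y = -1`.
  have hcd : c = d := by
    obtain ⟨y, hy⟩ := exists_int_coord_vec ha a b
    obtain ⟨z, hz⟩ := exists_int_coord_vec hb b a
    have h1 := coord_eq_zero_of_mem_linSpan ha (Finset.subset_insert a J) haJ hsum
    have h2 := coord_eq_zero_of_mem_linSpan hb (Finset.subset_insert b J) hbJ hsum
    rw [map_add, map_smul, map_smul, coord_vec ha (Finset.mem_insert_self a J), if_pos rfl, hy,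
      smul_eq_mul, smul_eq_mul] at h1
    rw [map_add, map_smul, map_smul, coord_vec hb (Finset.mem_insert_self b J), if_pos rfl, hz,
      smul_eq_mul, smul_eq_mul] at h2
    have hyz : (y : ℝ) * z = 1 := by
      have : d * c * ((y : ℝ) * z) = d * c * 1 := by
        linear_combination c * z * h1 - c * h2
      exact mul_left_cancel₀ (by positivity) this
    have hyz' : y * z = 1 := by exact_mod_cast hyz
    rcases Int.eq_one_or_neg_one_of_mul_eq_one hyz' with rfl | rfl
    · push_cast at h1; linarith
    · push_cast at h1; linarith
  subst hcd
  have hsum' : Δ.vec a + Δ.vec b ∈ Δ.linSpan J := by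
    rw [← smul_add] at hsum
    exact (Submodule.smul_mem_iff _ hc.ne').1 hsum
  refine ⟨a, b, haJ, hbJ, hab, ha, hb, fun i hiJ hi => ?_, hsum'⟩
  have hcard : (insert a J).card = n := by rw [Finset.card_insert_of_notMem haJ, hn]
  set r := Δ.coord (insert a J) a (Δ.vec i) with hr
  have hri : Δ.vec i - r • Δ.vec a ∈ Δ.linSpan J := by
    have h := sum_coord_smul ha hcard (Δ.vec i)
    rw [Finset.sum_insert haJ] at h
    rw [← h, add_sub_cancel_left]
    exact sum_smul_mem_linSpan _
  rcases lt_trichotomy r 0 with h | h | h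
  · right
    refine eq_of_same_side hJ hiJ hbJ hi hb (neg_pos.2 h) ?_
    have := Submodule.add_mem _ hri (Submodule.smul_mem _ r hsum')
    convert this using 1
    module
  · rw [h, zero_smul, sub_zero] at hri
    exact absurd hri (vec_notMem_linSpan hiJ hi)
  · exact Or.inl (eq_of_same_side hJ hiJ haJ hi ha h hri)

namespace IsWallPair

variable {a b : Fin m}

/-- Modulo the span of the wall, `vec b` is `-vec a`. This sign makes the two residues at a wall
cancel. -/
theorem coord_right (h : IsWallPair Δ J a b) (hn : J.card + 1 = n) (x : Fin n → ℝ) :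
    Δ.coord (insert b J) b x = - Δ.coord (insert a J) a x := by
  have h0 := coord_eq_zero_of_mem_linSpan h.right_mem (Finset.subset_insert b J) h.right_notMem
    h.add_mem
  rw [map_add, coord_vec h.right_mem (Finset.mem_insert_self b J), if_pos rfl] at h0
  have hx := sum_coord_smul h.left_mem
    (by rw [Finset.card_insert_of_notMem h.left_notMem, hn]) x
  rw [Finset.sum_insert h.left_notMem] at hx
  conv_lhs => rw [← hx]
  rw [map_add, coord_eq_zero_of_mem_linSpan h.right_mem (Finset.subset_insert b J) h.right_notMem
    (sum_smul_mem_linSpan _), map_smul, smul_eq_mul]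
  linear_combination Δ.coord (insert a J) a x * h0

theorem coord_eq (h : IsWallPair Δ J a b) (hn : J.card + 1 = n) {x : Fin n → ℝ}
    (hx : Δ.coord (insert a J) a x = 0) (i : Fin m) :
    Δ.coord (insert b J) i x = Δ.coord (insert a J) i x := by
  have hx' := sum_coord_smul h.left_mem
    (by rw [Finset.card_insert_of_notMem h.left_notMem, hn]) x
  rw [Finset.sum_insert h.left_notMem, hx, zero_smul, zero_add] at hx'
  conv_lhs => rw [← hx']
  rw [coord_sum_smul h.right_mem _ (Finset.subset_insert b J)]
  split_ifs with hi
  · rfl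
  · by_cases hia : i = a
    · rw [hia, hx]
    · rw [coord_of_notMem h.left_mem (by simp [hi, hia])]
      rfl

end IsWallPair

end CompleteUnimodularFan

end

/-! ### Localization and vanishing of integrals in low degree -/

noncomputable section

/-- The partial fraction decomposition, evaluated at `0`, of a polynomial divided by a product of
more than its degree many pairwise independent affine forms `β i + α i * s`. -/
theorem eval_zero_div_prod_eq_sum {ι : Type*} [DecidableEq ι] (I : Finset ι) (α β : ι → ℝ)
    (p : Polynomial ℝ) (hp : p.degree < I.card) (hα : ∀ i ∈ I, α i ≠ 0) (hβ : ∀ i ∈ I, β i ≠ 0)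
    (hne : ∀ i ∈ I, ∀ j ∈ I, i ≠ j → β i * α j - β j * α i ≠ 0) :
    p.eval 0 / ∏ i ∈ I, β i = ∑ i ∈ I, p.eval (-(β i / α i)) /
      ((∏ j ∈ I.erase i, (β j + α j * -(β i / α i))) * β i) := by
  have hinj : Set.InjOn (fun i => -(β i / α i)) (I : Set ι) := by
    intro i hi j hj h
    by_contra hij
    have h' : β i / α i = β j / α j := neg_injective h
    rw [div_eq_div_iff (hα i hi) (hα j hj)] at h'
    exact hne i hi j hj hij (sub_eq_zero.2 h')
  -- Lagrange interpolation at the zeros of the affine forms, evaluated at 0; the degree bound makes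
  -- it exact.
  have hp0 := congrArg (Polynomial.eval 0) (Lagrange.eq_interpolate hinj hp)
  rw [Lagrange.interpolate_apply, Polynomial.eval_finsetSum] at hp0
  rw [hp0, Finset.sum_div]
  refine Finset.sum_congr rfl fun i hi => ?_
  rw [Polynomial.eval_mul, Polynomial.eval_C, Lagrange.basis, Polynomial.eval_prod,
    ← Finset.prod_erase_mul I β hi, mul_div_assoc, div_eq_mul_inv (Polynomial.eval _ p)]
  congr 1
  have hprod : ∏ j ∈ I.erase i, Polynomial.eval 0
      (Lagrange.basisDivisor (-(β i / α i)) (-(β j / α j))) =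
      (∏ j ∈ I.erase i, β j) / ∏ j ∈ I.erase i, (β j + α j * -(β i / α i)) := by
    rw [← Finset.prod_div_distrib]
    refine Finset.prod_congr rfl fun j hj => ?_
    obtain ⟨hji, hj⟩ := Finset.mem_erase.1 hj
    have h1 := hα i hi
    have h2 := hα j hj
    have h3 := hne i hi j hj hji.symm
    have h4 : β j + α j * -(β i / α i) = -((β i * α j - β j * α i) / α i) := by field_simp; ring
    have h5 : -(β i / α i) - -(β j / α j) = -((β i * α j - β j * α i) / (α i * α j)) := by
      field_simp; ring
    rw [Lagrange.basisDivisor, h4, h5]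
    simp only [Polynomial.eval_mul, Polynomial.eval_C, Polynomial.eval_sub, Polynomial.eval_X]
    field_simp
    ring
  rw [hprod]
  have h6 : ∏ j ∈ I.erase i, β j ≠ 0 :=
    Finset.prod_ne_zero_iff.2 fun j hj => hβ j (Finset.mem_of_mem_erase hj)
  have h7 := hβ i hi
  generalize ∏ j ∈ I.erase i, (β j + α j * -(β i / α i)) = d
  field_simp

namespace CompleteUnimodularFan

variable {n m : ℕ} {Δ : CompleteUnimodularFan n m} {I J : Finset (Fin m)}

variable (Δ) in
open Classical in
/-- The simplices whose cones are full-dimensional. -/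
def maxSimplices : Finset (Finset (Fin m)) := {I | I ∈ Δ.K ∧ I.card = n}

theorem mem_maxSimplices : I ∈ Δ.maxSimplices ↔ I ∈ Δ.K ∧ I.card = n := by
  simp [maxSimplices]

variable (Δ) in
open Classical in
/-- The simplices of codimension one. -/
def wallSimplices : Finset (Finset (Fin m)) := {J | J ∈ Δ.K ∧ J.card + 1 = n}

theorem mem_wallSimplices : J ∈ Δ.wallSimplices ↔ J ∈ Δ.K ∧ J.card + 1 = n := by
  simp [wallSimplices]

variable (Δ) in
open Classical in
/-- The vertices completing `J` to a simplex with one vertex more. -/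
def completions (J : Finset (Fin m)) : Finset (Fin m) := {i | i ∉ J ∧ insert i J ∈ Δ.K}

theorem mem_completions {i : Fin m} : i ∈ Δ.completions J ↔ i ∉ J ∧ insert i J ∈ Δ.K := by
  simp [completions]

theorem IsWallPair.completions_eq {a b : Fin m} (h : IsWallPair Δ J a b) :
    Δ.completions J = {a, b} := by
  ext i
  rw [mem_completions, Finset.mem_insert, Finset.mem_singleton]
  refine ⟨fun hi => h.eq_or_eq i hi.1 hi.2, ?_⟩
  rintro (rfl | rfl)
  exacts [⟨h.left_notMem, h.left_mem⟩, ⟨h.right_notMem, h.right_mem⟩]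

/-- Regroups residues by wall, through the bijection of flags sending `(I, i)` to `(I.erase i, i)`.
-/
theorem sum_maxSimplices_eq_sum_wallSimplices (R : Finset (Fin m) → Fin m → ℝ) :
    ∑ I ∈ Δ.maxSimplices, ∑ i ∈ I, R I i =
      ∑ J ∈ Δ.wallSimplices, ∑ i ∈ Δ.completions J, R (insert i J) i := by
  rw [Finset.sum_sigma', Finset.sum_sigma']
  refine Finset.sum_bij' (fun x _ => ⟨x.1.erase x.2, x.2⟩) (fun x _ => ⟨insert x.2 x.1, x.2⟩)
    ?_ ?_ ?_ ?_ ?_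
  · rintro ⟨I, i⟩ h
    simp only [Finset.mem_sigma, mem_maxSimplices, mem_wallSimplices, mem_completions] at h ⊢
    obtain ⟨⟨hI, hn⟩, hi⟩ := h
    refine ⟨⟨Δ.down_closed I hI _ (Finset.erase_subset i I), ?_⟩, Finset.notMem_erase i I, ?_⟩
    · rw [Finset.card_erase_add_one hi, hn]
    · rwa [Finset.insert_erase hi]
  · rintro ⟨J, i⟩ h
    simp only [Finset.mem_sigma, mem_maxSimplices, mem_wallSimplices, mem_completions] at h ⊢
    obtain ⟨⟨-, hn⟩, hi, hI⟩ := h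
    exact ⟨⟨hI, by rw [Finset.card_insert_of_notMem hi, hn]⟩, Finset.mem_insert_self i J⟩
  · rintro ⟨I, i⟩ h
    simp only [Finset.mem_sigma] at h
    simp [Finset.insert_erase h.2]
  · rintro ⟨J, i⟩ h
    simp only [Finset.mem_sigma, mem_completions] at h
    simp [Finset.erase_insert h.2.1]
  · rintro ⟨I, i⟩ h
    simp only [Finset.mem_sigma] at h
    simp [Finset.insert_erase h.2]

variable (Δ) in
/-- `t` lies on no hyperplane spanned by a wall. -/
def IsGeneric (t : Fin n → ℝ) : Prop :=
  ∀ I ∈ Δ.maxSimplices, ∀ i ∈ I, Δ.coord I i t ≠ 0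

variable (Δ) in
theorem exists_isGeneric : ∃ t, Δ.IsGeneric t := by
  obtain ⟨t, ht⟩ := Module.Dual.exists_forall_ne_zero_of_forall_exists
    (fun p : {p : Finset (Fin m) × Fin m // p.1 ∈ Δ.maxSimplices ∧ p.2 ∈ p.1} =>
      Δ.coord p.1.1 p.1.2) fun p => ⟨Δ.vec p.1.2, by
        rw [coord_vec (mem_maxSimplices.1 p.2.1).1 p.2.2, if_pos rfl]; exact one_ne_zero⟩
  exact ⟨t, fun I hI i hi => ht ⟨(I, i), hI, hi⟩⟩

/-- For each maximal simplex, the line `t + s • w` then meets the coordinate hyperplanes at distinct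
parameters, so all poles are simple. Each condition is the nonvanishing at `w` of one of finitely
many nonzero linear forms. -/
theorem IsGeneric.exists_direction {t : Fin n → ℝ} (ht : Δ.IsGeneric t) :
    ∃ w, Δ.IsGeneric w ∧ ∀ I ∈ Δ.maxSimplices, ∀ i ∈ I, ∀ j ∈ I, i ≠ j →
      Δ.coord I i t * Δ.coord I j w - Δ.coord I j t * Δ.coord I i w ≠ 0 := by
  obtain ⟨w, hw⟩ := Module.Dual.exists_forall_ne_zero_of_forall_exists
    (fun p : {p : Finset (Fin m) × Fin m × Fin m //
        p.1 ∈ Δ.maxSimplices ∧ p.2.1 ∈ p.1 ∧ p.2.2 ∈ p.1} =>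
      if p.1.2.1 = p.1.2.2 then Δ.coord p.1.1 p.1.2.1
      else Δ.coord p.1.1 p.1.2.1 t • Δ.coord p.1.1 p.1.2.2 -
        Δ.coord p.1.1 p.1.2.2 t • Δ.coord p.1.1 p.1.2.1) (by
      rintro ⟨⟨I, i, j⟩, hI, hi, hj⟩
      have hIK := (mem_maxSimplices.1 hI).1
      refine ⟨Δ.vec j, ?_⟩
      dsimp only at hi hj ⊢
      split_ifs with hij
      · rw [coord_vec hIK hj, if_pos hij]; exact one_ne_zero
      · simpa [coord_vec hIK hj, hij] using ht I hI i hi)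
  refine ⟨w, fun I hI i hi => ?_, fun I hI i hi j hj hij => ?_⟩
  · simpa using hw ⟨(I, i, i), hI, hi, hi⟩
  · simpa [hij] using hw ⟨(I, i, j), hI, hi, hj⟩

variable (Δ) in
/-- Restriction of a polynomial to the maximal simplex `I`, evaluated at `t`. -/
def restrict (I : Finset (Fin m)) (t : Fin n → ℝ) : MvPolynomial (Fin m) ℝ →ₐ[ℝ] ℝ :=
  MvPolynomial.aeval fun i => Δ.coord I i t

variable (Δ) in
/-- Integration over the toric variety, by localization at the torus fixed points. -/
def integral (t : Fin n → ℝ) : MvPolynomial (Fin m) ℝ →ₗ[ℝ] ℝ :=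
  ∑ I ∈ Δ.maxSimplices, (∏ i ∈ I, Δ.coord I i t)⁻¹ • (Δ.restrict I t).toLinearMap

theorem integral_apply (t : Fin n → ℝ) (f : MvPolynomial (Fin m) ℝ) :
    Δ.integral t f = ∑ I ∈ Δ.maxSimplices, Δ.restrict I t f / ∏ i ∈ I, Δ.coord I i t := by
  rw [integral, LinearMap.sum_apply]
  refine Finset.sum_congr rfl fun I _ => ?_
  rw [LinearMap.smul_apply, AlgHom.toLinearMap_apply, smul_eq_mul, div_eq_inv_mul]

theorem exists_polynomial_restrict (I : Finset (Fin m)) (t w : Fin n → ℝ)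
    (f : MvPolynomial (Fin m) ℝ) : ∃ p : Polynomial ℝ, p.natDegree ≤ f.totalDegree ∧
      ∀ s, p.eval s = Δ.restrict I (t + s • w) f := by
  refine ⟨MvPolynomial.aeval (fun i => Polynomial.C (Δ.coord I i t) +
    Polynomial.C (Δ.coord I i w) * Polynomial.X) f, ?_, fun s => ?_⟩
  · simpa using MvPolynomial.aeval_natDegree_le f le_rfl _ (n := 1) fun i => by compute_degree
  · have : (Polynomial.aeval s).comp (MvPolynomial.aeval (fun i => Polynomial.C (Δ.coord I i t) +
        Polynomial.C (Δ.coord I i w) * Polynomial.X)) = Δ.restrict I (t + s • w) := by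
      ext i
      simp only [restrict, AlgHom.comp_apply, MvPolynomial.aeval_X, map_add, map_mul,
        Polynomial.aeval_C, Polynomial.aeval_X, map_smul, smul_eq_mul, Algebra.algebraMap_self,
        RingHom.id_apply, mul_comm]
    rw [← this, AlgHom.comp_apply, Polynomial.coe_aeval_eq_eval]

/-- Each summand, restricted to the line `t + s • w`, has numerator of degree below `n` and `n`
simple poles, so at `s = 0` it is the sum of its partial fractions. The pole of `i ∈ I` lies on the
hyperplane of the wall `I.erase i`, where the contributions of the two adjacent simplices cancel. -/
theorem integral_eq_zero {t : Fin n → ℝ} (ht : Δ.IsGeneric t) {f : MvPolynomial (Fin m) ℝ}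
    (hf : f.totalDegree < n) : Δ.integral t f = 0 := by
  obtain ⟨w, hw, htw⟩ := ht.exists_direction
  set q : Finset (Fin m) → Fin m → (Fin n → ℝ) := fun I i =>
    t + (-(Δ.coord I i t / Δ.coord I i w)) • w with hq
  set R : Finset (Fin m) → Fin m → ℝ := fun I i => Δ.restrict I (q I i) f /
    ((∏ j ∈ I.erase i, Δ.coord I j (q I i)) * Δ.coord I i t) with hR
  have h1 : Δ.integral t f = ∑ I ∈ Δ.maxSimplices, ∑ i ∈ I, R I i := by
    rw [integral_apply]
    refine Finset.sum_congr rfl fun I hI => ?_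
    obtain ⟨p, hpd, hp⟩ := exists_polynomial_restrict (Δ := Δ) I t w f
    have hdeg : p.degree < I.card := by
      rw [(mem_maxSimplices.1 hI).2]
      exact lt_of_le_of_lt Polynomial.degree_le_natDegree (by exact_mod_cast hpd.trans_lt hf)
    have := eval_zero_div_prod_eq_sum I (fun i => Δ.coord I i w) (fun i => Δ.coord I i t) p hdeg
      (hw I hI) (ht I hI) (htw I hI)
    rw [hp, zero_smul, add_zero] at this
    rw [this]
    refine Finset.sum_congr rfl fun i _ => ?_
    simp only [hR, hq, hp, map_add, map_smul, smul_eq_mul]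
    congr 2
    exact Finset.prod_congr rfl fun j _ => by ring
  rw [h1, sum_maxSimplices_eq_sum_wallSimplices]
  refine Finset.sum_eq_zero fun J hJ => ?_
  obtain ⟨hJK, hn⟩ := mem_wallSimplices.1 hJ
  obtain ⟨a, b, h⟩ := exists_isWallPair hJK hn
  have hA : insert a J ∈ Δ.maxSimplices :=
    mem_maxSimplices.2 ⟨h.left_mem, by rw [Finset.card_insert_of_notMem h.left_notMem, hn]⟩
  have hwa := hw _ hA a (Finset.mem_insert_self a J)
  -- The line meets the hyperplane of the wall in one point, whichever side is used to compute it.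
  -- There the coordinates of both simplices agree by `coord_eq`.
  have hqq : q (insert b J) b = q (insert a J) a := by
    simp only [hq, h.coord_right hn, neg_div_neg_eq]
  have hq0 : Δ.coord (insert a J) a (q (insert a J) a) = 0 := by
    simp only [hq, map_add, map_smul, smul_eq_mul]
    field_simp
    ring
  have hc := h.coord_eq hn hq0
  rw [h.completions_eq, Finset.sum_pair h.ne]
  simp only [hR, hqq, Finset.erase_insert h.left_notMem, Finset.erase_insert h.right_notMem,
    restrict, hc, h.coord_right hn t]
  rw [mul_neg, div_neg, add_neg_cancel]

end CompleteUnimodularFan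

end

/-! ### The divisor of the polytope and its degree on wall classes -/

noncomputable section

/-- Lets the degree functional be tested on arbitrary multiples of the homogeneous generators of the
two ideals. -/
theorem MvPolynomial.homogeneousComponent_mul_of_isHomogeneous {σ : Type*}
    {p : MvPolynomial σ ℝ} {d : ℕ} (hp : p.IsHomogeneous d) (g : MvPolynomial σ ℝ) (k : ℕ) :
    MvPolynomial.homogeneousComponent k (g * p) =
      if d ≤ k then MvPolynomial.homogeneousComponent (k - d) g * p else 0 := by
  have hmem (i : ℕ) : MvPolynomial.homogeneousComponent k
      (MvPolynomial.homogeneousComponent i g * p) =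
      if k = i + d then MvPolynomial.homogeneousComponent i g * p else 0 :=
    MvPolynomial.homogeneousComponent_of_mem ((MvPolynomial.mem_homogeneousSubmodule _ _).2
      ((MvPolynomial.homogeneousComponent_isHomogeneous i g).mul hp))
  conv_lhs => rw [← MvPolynomial.sum_homogeneousComponent g, Finset.sum_mul, map_sum]
  simp only [hmem]
  split_ifs with hd
  · rw [Finset.sum_eq_single (k - d)]
    · rw [if_pos (by omega)]
    · exact fun i _ hi => if_neg (by omega)
    · intro hi
      rw [MvPolynomial.homogeneousComponent_eq_zero _ _ (by simp at hi; omega), zero_mul, ite_self]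
  · exact Finset.sum_eq_zero fun i _ => if_neg (by omega)

/-- Points of a face `F` maximize all linear forms in the normal cone of `F`. -/
theorem dotProduct_le_of_mem_normalCone {n : ℕ} {P F : Set (Fin n → ℝ)} {y : Fin n → ℝ}
    (hy : y ∈ normalCone P F) {q : Fin n → ℝ} (hq : q ∈ F) {x : Fin n → ℝ} (hx : x ∈ P) :
    x ⬝ᵥ y ≤ q ⬝ᵥ y := by
  induction hy using Submodule.span_induction with
  | mem y hy =>
    obtain ⟨G, -, hFG, -, h⟩ := hy
    exact h q (hFG hq) x hx
  | zero => simp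
  | add y z _ _ hy hz => rw [dotProduct_add, dotProduct_add]; exact add_le_add hy hz
  | smul a y _ hy =>
    change x ⬝ᵥ ((a : ℝ) • y) ≤ q ⬝ᵥ ((a : ℝ) • y)
    rw [dotProduct_smul, dotProduct_smul]
    exact mul_le_mul_of_nonneg_left hy a.2

namespace CompleteUnimodularFan

variable {n m : ℕ} {Δ : CompleteUnimodularFan n m} {I J : Finset (Fin m)}
  {P : Set (Fin n → ℝ)}

variable (Δ) in
/-- `p` is the vertex of the polytope `P` corresponding to the simplex `I`. -/
def IsVertexOf (P : Set (Fin n → ℝ)) (I : Finset (Fin m)) (p : Fin n → ℝ) : Prop :=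
  p ∈ P ∧ ∀ k ∈ I, ∀ x ∈ P, x ⬝ᵥ Δ.vec k ≤ p ⬝ᵥ Δ.vec k

theorem vec_mem_cone {k : Fin m} (hk : k ∈ I) : Δ.vec k ∈ Δ.cone I :=
  Submodule.subset_span ⟨k, hk, rfl⟩

theorem exists_face_eq (hP : normalFan P = Δ.cones) (hI : I ∈ Δ.K) :
    ∃ F : Set (Fin n → ℝ), F.Nonempty ∧ Δ.cone I = normalCone P F ∧
      ∀ q ∈ F, Δ.IsVertexOf P I q := by
  have hmem : Δ.cone I ∈ normalFan P := by rw [hP]; exact ⟨I, hI, rfl⟩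
  obtain ⟨F, ⟨hne, hexp⟩, hF⟩ := hmem
  exact ⟨F, hne, hF, fun q hq => ⟨hexp.subset hq, fun k hk x hx =>
    dotProduct_le_of_mem_normalCone (hF ▸ vec_mem_cone hk) hq hx⟩⟩

theorem IsVertexOf.dotProduct_eq {p q : Fin n → ℝ} (hp : Δ.IsVertexOf P I p)
    (hq : Δ.IsVertexOf P J q) {k : Fin m} (hkI : k ∈ I) (hkJ : k ∈ J) :
    p ⬝ᵥ Δ.vec k = q ⬝ᵥ Δ.vec k :=
  le_antisymm (hq.2 k hkJ p hp.1) (hp.2 k hkI q hq.1)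

theorem dotProduct_eq_sum (hI : I ∈ Δ.maxSimplices) (p t : Fin n → ℝ) :
    p ⬝ᵥ t = ∑ i ∈ I, Δ.coord I i t * (p ⬝ᵥ Δ.vec i) := by
  obtain ⟨hIK, hn⟩ := mem_maxSimplices.1 hI
  conv_lhs => rw [← sum_coord_smul hIK hn t, dotProduct_sum]
  simp only [dotProduct_smul, smul_eq_mul]

theorem IsVertexOf.eq {p q : Fin n → ℝ} (hI : I ∈ Δ.maxSimplices) (hp : Δ.IsVertexOf P I p)
    (hq : Δ.IsVertexOf P I q) : p = q := by
  refine _root_.dotProduct_eq _ _ fun t => ?_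
  rw [dotProduct_eq_sum hI, dotProduct_eq_sum hI]
  exact Finset.sum_congr rfl fun i hi => by rw [hp.dotProduct_eq hq hi hi]

theorem subset_of_cone_eq (hI : I ∈ Δ.K) (hJ : J ∈ Δ.K) (h : Δ.cone I = Δ.cone J) : I ⊆ J := by
  intro k hk
  by_contra hkJ
  have h1 : Δ.vec k ∈ Δ.cone (I ∩ J) := by
    rw [← cone_inf_cone hI hJ, ← h, inf_idem]; exact vec_mem_cone hk
  have h2 := coord_eq_zero_of_mem_linSpan (i := k) hI Finset.inter_subset_left (by simp [hkJ])
    (cone_le_linSpan h1)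
  rw [coord_vec hI hk, if_pos rfl] at h2
  exact one_ne_zero h2

/-- A maximal simplex pins down its vertex, so its face is the single point `p`, and its cone is the
normal cone of `{p}`. Both simplices thus have the same cone. -/
theorem IsVertexOf.simplex_subset (hP : normalFan P = Δ.cones) {p : Fin n → ℝ}
    (hI : I ∈ Δ.maxSimplices) (hJ : J ∈ Δ.maxSimplices) (hpI : Δ.IsVertexOf P I p)
    (hpJ : Δ.IsVertexOf P J p) : I ⊆ J := by
  have key {I : Finset (Fin m)} (hI : I ∈ Δ.maxSimplices) (hp : Δ.IsVertexOf P I p) :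
      Δ.cone I = normalCone P {p} := by
    obtain ⟨F, hne, hF, hv⟩ := exists_face_eq hP (mem_maxSimplices.1 hI).1
    have hFp : F = {p} := hne.subset_singleton_iff.1 fun q hq => (hv q hq).eq hI hp
    rw [hF, hFp]
  exact subset_of_cone_eq (mem_maxSimplices.1 hI).1 (mem_maxSimplices.1 hJ).1
    ((key hI hpI).trans (key hJ hpJ).symm)

variable (Δ) in
/-- The ample divisor class given by the support function of the polytope `P`. -/
def divisor (P : Set (Fin n → ℝ)) : MvPolynomial (Fin m) ℝ :=
  ∑ i, MvPolynomial.C (sSup ((fun x => x ⬝ᵥ Δ.vec i) '' P)) * MvPolynomial.X i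

theorem isHomogeneous_divisor : (Δ.divisor P).IsHomogeneous 1 :=
  MvPolynomial.IsHomogeneous.sum _ _ _ fun i _ => by
    simpa using (MvPolynomial.isHomogeneous_C (Fin m) _).mul (MvPolynomial.isHomogeneous_X ℝ i)

theorem restrict_sum_C_mul_X (hI : I ∈ Δ.K) (t : Fin n → ℝ) (c : Fin m → ℝ) :
    Δ.restrict I t (∑ i, MvPolynomial.C (c i) * MvPolynomial.X i) =
      ∑ i ∈ I, Δ.coord I i t * c i := by
  rw [map_sum, ← Finset.sum_subset (Finset.subset_univ I)]
  · refine Finset.sum_congr rfl fun i _ => ?_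
    rw [map_mul, restrict, MvPolynomial.aeval_X, MvPolynomial.aeval_C, mul_comm]
    rfl
  · intro i _ hi
    rw [map_mul, restrict, MvPolynomial.aeval_X, coord_of_notMem hI hi, LinearMap.zero_apply,
      mul_zero]

/-- For `i ∈ I` the supremum in the coefficient is attained at `p`, so the support function agrees
with the linear form `p` on the cone of `I`. -/
theorem restrict_divisor (hI : I ∈ Δ.maxSimplices) {p : Fin n → ℝ} (hp : Δ.IsVertexOf P I p)
    (t : Fin n → ℝ) : Δ.restrict I t (Δ.divisor P) = p ⬝ᵥ t := by
  rw [divisor, restrict_sum_C_mul_X (mem_maxSimplices.1 hI).1, dotProduct_eq_sum hI]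
  refine Finset.sum_congr rfl fun i hi => ?_
  have : IsGreatest ((fun x => x ⬝ᵥ Δ.vec i) '' P) (p ⬝ᵥ Δ.vec i) :=
    ⟨⟨p, hp.1, rfl⟩, by rintro _ ⟨x, hx, rfl⟩; exact hp.2 i hi x hx⟩
  rw [this.csSup_eq]

theorem restrict_prod_X (I J : Finset (Fin m)) (t : Fin n → ℝ) :
    Δ.restrict I t (∏ j ∈ J, MvPolynomial.X j) = ∏ j ∈ J, Δ.coord I j t := by
  rw [map_prod]
  exact Finset.prod_congr rfl fun j _ => MvPolynomial.aeval_X _ _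

theorem restrict_prod_X_eq_zero (hI : I ∈ Δ.K) (h : ¬ J ⊆ I) (t : Fin n → ℝ) :
    Δ.restrict I t (∏ j ∈ J, MvPolynomial.X j) = 0 := by
  obtain ⟨j, hj, hjI⟩ := Finset.not_subset.1 h
  rw [restrict_prod_X]
  exact Finset.prod_eq_zero hj (by rw [coord_of_notMem hI hjI]; rfl)

variable (Δ) in
/-- The degree of the intersection of a curve class with the divisor of `P`. -/
def divisorDegree (t : Fin n → ℝ) (P : Set (Fin n → ℝ)) : MvPolynomial (Fin m) ℝ →ₗ[ℝ] ℝ :=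
  Δ.integral t ∘ₗ LinearMap.mulRight ℝ (Δ.divisor P) ∘ₗ MvPolynomial.homogeneousComponent (n - 1)

theorem divisorDegree_apply (t : Fin n → ℝ) (f : MvPolynomial (Fin m) ℝ) :
    Δ.divisorDegree t P f =
      Δ.integral t (MvPolynomial.homogeneousComponent (n - 1) f * Δ.divisor P) := rfl

theorem isHomogeneous_prod_X (J : Finset (Fin m)) :
    (∏ i ∈ J, (MvPolynomial.X i : MvPolynomial (Fin m) ℝ)).IsHomogeneous J.card := by
  simpa using MvPolynomial.IsHomogeneous.prod J
    (fun i => (MvPolynomial.X i : MvPolynomial (Fin m) ℝ)) (fun _ => 1)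
    (fun i _ => MvPolynomial.isHomogeneous_X ℝ i)

theorem divisorDegree_eq_zero_of_mem_stanleyReisnerIdeal {t : Fin n → ℝ}
    {f : MvPolynomial (Fin m) ℝ} (hf : f ∈ Δ.stanleyReisnerIdeal) :
    Δ.divisorDegree t P f = 0 := by
  rw [stanleyReisnerIdeal] at hf
  induction hf using Submodule.closure_induction with
  | zero => exact map_zero _
  | add x y _ _ hx hy => rw [map_add, hx, hy, add_zero]
  | smul_mem g x hx =>
    obtain ⟨S, hS, rfl⟩ := hx
    rw [divisorDegree_apply, smul_eq_mul,
      MvPolynomial.homogeneousComponent_mul_of_isHomogeneous (isHomogeneous_prod_X S)]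
    split_ifs
    · rw [integral_apply]
      refine Finset.sum_eq_zero fun I hI => ?_
      have hIK := (mem_maxSimplices.1 hI).1
      rw [map_mul, map_mul, restrict_prod_X_eq_zero hIK fun h => hS (Δ.down_closed I hIK S h)]
      simp
    · rw [zero_mul, map_zero]

variable (Δ) in
/-- The linear form `∑ ⟨μ, lam i⟩ v_i`. -/
def linearForm (μ : (Fin n → ℤ) →ₗ[ℤ] ℤ) : MvPolynomial (Fin m) ℝ :=
  ∑ i, MvPolynomial.C ((μ (Δ.lam i) : ℤ) : ℝ) * MvPolynomial.X i

theorem isHomogeneous_linearForm (μ : (Fin n → ℤ) →ₗ[ℤ] ℤ) :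
    (Δ.linearForm μ).IsHomogeneous 1 :=
  MvPolynomial.IsHomogeneous.sum _ _ _ fun i _ => by
    simpa only [zero_add] using
      (MvPolynomial.isHomogeneous_C (Fin m) _).mul (MvPolynomial.isHomogeneous_X ℝ i)

theorem restrict_linearForm (hI : I ∈ Δ.maxSimplices) (μ : (Fin n → ℤ) →ₗ[ℤ] ℤ)
    (t : Fin n → ℝ) : Δ.restrict I t (Δ.linearForm μ) = realExtension μ t := by
  obtain ⟨hIK, hn⟩ := mem_maxSimplices.1 hI
  rw [linearForm, restrict_sum_C_mul_X hIK]
  conv_rhs => rw [← sum_coord_smul hIK hn t, map_sum]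
  exact Finset.sum_congr rfl fun i _ => by
    rw [map_smul, smul_eq_mul, vec, realExtension_latticeVec]

/-- A linear form restricts to the same scalar at all maximal simplices; once it is pulled out, the
integrand has degree less than `n`. -/
theorem divisorDegree_eq_zero_of_mem_linearIdeal {t : Fin n → ℝ} (ht : Δ.IsGeneric t)
    {f : MvPolynomial (Fin m) ℝ} (hf : f ∈ Δ.linearIdeal) : Δ.divisorDegree t P f = 0 := by
  rw [linearIdeal] at hf
  induction hf using Submodule.closure_induction with
  | zero => exact map_zero _
  | add x y _ _ hx hy => rw [map_add, hx, hy, add_zero]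
  | smul_mem g x hx =>
    obtain ⟨μ, rfl⟩ := hx
    change Δ.divisorDegree t P (g • Δ.linearForm μ) = 0
    rw [divisorDegree_apply, smul_eq_mul,
      MvPolynomial.homogeneousComponent_mul_of_isHomogeneous (isHomogeneous_linearForm μ)]
    split_ifs with h1
    · set g' := MvPolynomial.homogeneousComponent (n - 1 - 1) g
      have hdeg : (g' * Δ.divisor P).totalDegree < n := by
        have h2 := ((MvPolynomial.homogeneousComponent_isHomogeneous (n - 1 - 1) g).mul
          (isHomogeneous_divisor (Δ := Δ) (P := P))).totalDegree_le
        exact h2.trans_lt (by omega)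
      have h0 := integral_eq_zero ht hdeg
      have : Δ.integral t (g' * Δ.linearForm μ * Δ.divisor P) =
          realExtension μ t * Δ.integral t (g' * Δ.divisor P) := by
        rw [integral_apply, integral_apply, Finset.mul_sum]
        refine Finset.sum_congr rfl fun I hI => ?_
        rw [map_mul, map_mul, map_mul, restrict_linearForm hI]
        ring
      rw [this, h0, mul_zero]
    · rw [zero_mul, map_zero]

theorem IsWallPair.filter_maxSimplices {a b : Fin m} (h : IsWallPair Δ J a b)
    (hn : J.card + 1 = n) :
    Δ.maxSimplices.filter (J ⊆ ·) = {insert a J, insert b J} := by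
  ext I
  simp only [Finset.mem_filter, mem_maxSimplices, Finset.mem_insert, Finset.mem_singleton]
  constructor
  · rintro ⟨⟨hI, hIn⟩, hJI⟩
    obtain ⟨i, hi, hiI⟩ := (Finset.exists_eq_insert_iff (s := J) (t := I)).2 ⟨hJI, by omega⟩
    subst hiI
    rcases h.eq_or_eq i hi hI with rfl | rfl <;> simp
  · rintro (rfl | rfl)
    · exact ⟨⟨h.left_mem, by rw [Finset.card_insert_of_notMem h.left_notMem, hn]⟩,
        Finset.subset_insert _ _⟩
    · exact ⟨⟨h.right_mem, by rw [Finset.card_insert_of_notMem h.right_notMem, hn]⟩,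
        Finset.subset_insert _ _⟩

/-- Only the vertices `p`, `q` of the two simplices around the wall contribute. They pair equally
with the generators of `J`, so `t` drops out and the drop of `vec a` along the edge from `p` to `q`
remains. -/
theorem divisorDegree_prod_X_pos (hP : normalFan P = Δ.cones) {t : Fin n → ℝ}
    (ht : Δ.IsGeneric t) (hJ : J ∈ Δ.K) (hn : J.card + 1 = n) :
    0 < Δ.divisorDegree t P (∏ j ∈ J, MvPolynomial.X j) := by
  obtain ⟨a, b, h⟩ := exists_isWallPair hJ hn
  have hfilter := h.filter_maxSimplices hn
  have hA : insert a J ∈ Δ.maxSimplices :=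
    (Finset.mem_filter.1 (hfilter.symm ▸ Finset.mem_insert_self _ _)).1
  have hB : insert b J ∈ Δ.maxSimplices :=
    (Finset.mem_filter.1 (hfilter.symm ▸ Finset.mem_insert_of_mem
      (Finset.mem_singleton_self _))).1
  have hbA : b ∉ insert a J := by simp [h.right_notMem, h.ne.symm]
  have haB : a ∉ insert b J := by simp [h.left_notMem, h.ne]
  have hAB : insert a J ≠ insert b J := fun hab => haB (hab ▸ Finset.mem_insert_self a J)
  obtain ⟨F, ⟨p, hpF⟩, -, hF⟩ := exists_face_eq hP h.left_mem
  obtain ⟨G, ⟨q, hqG⟩, -, hG⟩ := exists_face_eq hP h.right_mem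
  have hp := hF p hpF
  have hq := hG q hqG
  have hcomp : MvPolynomial.homogeneousComponent (n - 1)
      (∏ j ∈ J, MvPolynomial.X j : MvPolynomial (Fin m) ℝ) = ∏ j ∈ J, MvPolynomial.X j := by
    rw [MvPolynomial.homogeneousComponent_of_mem
      ((MvPolynomial.mem_homogeneousSubmodule _ _).2 (isHomogeneous_prod_X J)),
      if_pos (by omega)]
  have hlocal {i : Fin m} {I : Finset (Fin m)} (hi : i ∉ J) (hI : insert i J = I)
      (hmax : I ∈ Δ.maxSimplices) {r : Fin n → ℝ}
      (hr : Δ.IsVertexOf P I r) : Δ.restrict I t ((∏ j ∈ J, MvPolynomial.X j) *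
        Δ.divisor P) / ∏ j ∈ I, Δ.coord I j t = r ⬝ᵥ t / Δ.coord I i t := by
    rw [map_mul, restrict_prod_X, restrict_divisor hmax hr]
    subst hI
    have hJ0 : ∏ j ∈ J, Δ.coord (insert i J) j t ≠ 0 := Finset.prod_ne_zero_iff.2
      fun j hj => ht _ hmax j (Finset.mem_insert_of_mem hj)
    rw [Finset.prod_insert hi, mul_comm (Δ.coord (insert i J) i t), mul_div_mul_left _ _ hJ0]
  have ha0 := ht _ hA a (Finset.mem_insert_self a J)
  have hval : Δ.divisorDegree t P (∏ j ∈ J, MvPolynomial.X j) =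
      p ⬝ᵥ Δ.vec a - q ⬝ᵥ Δ.vec a := by
    rw [divisorDegree_apply, hcomp, integral_apply,
      ← Finset.sum_subset (Finset.filter_subset (J ⊆ ·) Δ.maxSimplices), hfilter,
      Finset.sum_pair hAB, hlocal h.left_notMem rfl hA hp, hlocal h.right_notMem rfl hB hq,
      h.coord_right hn, div_neg, ← sub_eq_add_neg, ← sub_div, div_eq_iff ha0,
      dotProduct_eq_sum hA p, dotProduct_eq_sum hA q, Finset.sum_insert h.left_notMem,
      Finset.sum_insert h.left_notMem]
    · have : ∑ j ∈ J, Δ.coord (insert a J) j t * (p ⬝ᵥ Δ.vec j) =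
          ∑ j ∈ J, Δ.coord (insert a J) j t * (q ⬝ᵥ Δ.vec j) :=
        Finset.sum_congr rfl fun j hj => by
          rw [hp.dotProduct_eq hq (Finset.mem_insert_of_mem hj) (Finset.mem_insert_of_mem hj)]
      rw [this]
      ring
    · intro I hI hIJ
      rw [map_mul, restrict_prod_X_eq_zero (mem_maxSimplices.1 hI).1
        fun hJI => hIJ (Finset.mem_filter.2 ⟨hI, hJI⟩), zero_mul, zero_div]
  rw [hval, sub_pos]
  -- In case of equality `q` would also be the vertex of `insert a J`, and one vertex cannot serve
  -- two maximal simplices.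
  refine (hp.2 a (Finset.mem_insert_self a J) q hq.1).lt_of_ne fun hqp => ?_
  have hqA : Δ.IsVertexOf P (insert a J) q := by
    refine ⟨hq.1, fun k hk x hx => ?_⟩
    rcases Finset.mem_insert.1 hk with rfl | hkJ
    · rw [hqp]; exact hp.2 k hk x hx
    · exact hq.2 k (Finset.mem_insert_of_mem hkJ) x hx
  exact haB (hqA.simplex_subset hP hA hB hq (Finset.mem_insert_self a J))

/-- On a polytopal fan there is a linear functional which is positive on all wall classes. -/
theorem exists_functional_pos (hΔ : Δ.IsPolytopal) :
    ∃ ψ : Δ.evenCohomology (n - 1) →ₗ[ℝ] ℝ, ∀ J : Δ.Wall, 0 < ψ (Δ.wallClass J) := by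
  obtain ⟨P, -, hP⟩ := hΔ
  obtain ⟨t, ht⟩ := Δ.exists_isGeneric
  set π := (Ideal.Quotient.mkₐ ℝ (Δ.stanleyReisnerIdeal ⊔ Δ.linearIdeal)).toLinearMap with hπ
  obtain ⟨g, hg⟩ := π.exists_rightInverse_of_surjective
    (LinearMap.range_eq_top.2 (Ideal.Quotient.mkₐ_surjective ℝ _))
  -- Vanishing on the kernel of `π` makes the composite with the section `g` independent of the
  -- choice of representatives.
  have hker {f : MvPolynomial (Fin m) ℝ} (hf : π f = 0) : Δ.divisorDegree t P f = 0 := by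
    obtain ⟨x, hx, y, hy, rfl⟩ := Submodule.mem_sup.1 (Ideal.Quotient.eq_zero_iff_mem.1 hf)
    rw [map_add, divisorDegree_eq_zero_of_mem_stanleyReisnerIdeal hx,
      divisorDegree_eq_zero_of_mem_linearIdeal ht hy, add_zero]
  refine ⟨Δ.divisorDegree t P ∘ₗ g ∘ₗ Submodule.subtype _, fun J => ?_⟩
  set f : MvPolynomial (Fin m) ℝ := ∏ j ∈ J.1, MvPolynomial.X j with hf
  have hJ : (Δ.wallClass J : Δ.Cohomology) = π f := by
    rw [hπ, AlgHom.toLinearMap_apply, hf, map_prod]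
    rfl
  have h0 : π (g (π f) - f) = 0 := by
    rw [map_sub, ← LinearMap.comp_apply π g, hg, LinearMap.id_apply, sub_self]
  have h1 := hker h0
  rw [map_sub, sub_eq_zero] at h1
  rw [LinearMap.comp_apply, LinearMap.comp_apply, Submodule.subtype_apply, hJ, h1]
  exact divisorDegree_prod_X_pos hP ht J.2.1 J.2.2

instance : Finite Δ.Wall :=
  inferInstanceAs (Finite {J : Finset (Fin m) // J ∈ Δ.K ∧ J.card + 1 = n})

end CompleteUnimodularFan

/-! ### Strict convexity from a positive functional -/

theorem PointedCone.eq_zero_or_pos_of_mem_hull {E : Type*} [AddCommGroup E] [Module ℝ E]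
    {s : Set E} {ψ : E →ₗ[ℝ] ℝ} (hψ : ∀ x ∈ s, 0 < ψ x) {x : E}
    (hx : x ∈ PointedCone.hull ℝ s) : x = 0 ∨ 0 < ψ x := by
  induction hx using Submodule.span_induction with
  | mem x hx => exact Or.inr (hψ x hx)
  | zero => exact Or.inl rfl
  | add x y _ _ hx hy =>
    rcases hx with rfl | hx
    · rwa [zero_add]
    · rcases hy with rfl | hy
      · rw [add_zero]; exact Or.inr hx
      · rw [map_add]; exact Or.inr (add_pos hx hy)
  | smul a x _ hx =>
    change (a : ℝ) • x = 0 ∨ 0 < ψ ((a : ℝ) • x)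
    rcases hx with rfl | hx
    · exact Or.inl (smul_zero _)
    · rcases a.2.eq_or_lt with ha | ha
      · left
        rw [← ha, zero_smul]
      · right
        rw [map_smul]
        exact mul_pos ha hx

end

/-- For a smooth projective toric variety `X_Δ`, the effective cone `NE(X_Δ)` is polyhedral
(finitely generated) and strictly convex (it contains no line), and its generators `v_J` are
nonzero. -/
theorem mainTheorem5 {n m : ℕ} (Δ : CompleteUnimodularFan n m) (hΔ : Δ.IsPolytopal) :
    Δ.effectiveCone.FG ∧
    (Δ.effectiveCone : ConvexCone ℝ (Δ.evenCohomology (n - 1))).Salient ∧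
    ∀ J : Δ.Wall, Δ.wallClass J ≠ 0 := by
  obtain ⟨ψ, hψ⟩ := Δ.exists_functional_pos hΔ
  have hψ' : ∀ x ∈ Set.range Δ.wallClass, 0 < ψ x := by
    rintro _ ⟨J, rfl⟩
    exact hψ J
  refine ⟨Submodule.fg_span (Set.finite_range _), fun x hx hx0 hnx => ?_, fun J hJ => ?_⟩
  · have h1 := (PointedCone.eq_zero_or_pos_of_mem_hull hψ' hx).resolve_left hx0
    have h2 := (PointedCone.eq_zero_or_pos_of_mem_hull hψ' hnx).resolve_left (neg_ne_zero.2 hx0)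
    rw [map_neg] at h2
    linarith
  · have := hψ J
    rw [hJ, map_zero] at this
    exact lt_irrefl _ this
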